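/- For a finite connected simple (unweighted) graph $G=(V,E)$, consider the simple random walk on $G$, which at each step moves to a uniformly random neighbour of its current vertex (for the one-vertex graph the walk stays put). Let $H_G(u,v)$ be the expected number of steps the walk started at $u$ takes until it first visits $v$ (so $H_G(u,u)=0$), let $\pi_G$ be the stationary distribution of the walk, and define the average hitting time and Kemeny's constant by $$\alpha(G)=\frac{1}{|V|^2}\sum_{u\in V}\sum_{v\in V}H_G(u,v),\qquad \kappa(G)=\sum_{v\in V}H_G(u,v)\,\pi_G(v),$$ where the value of $\kappa(G)$ does not depend on the choice of the starting vertex $u\in V$. Let $n\ge 1$, let $P_n$ be the path and $S_n$ the star on $n$ vertices. Then for every simple tree $T$ on $n$ vertices, all these quantities are finite, $\kappa(T)$ is independent of the starting vertex, and $$\alpha(S_n)\le\alpha(T)\le\alpha(P_n),\qquad \kappa(S_n)\le\kappa(T)\le\kappa(P_n).$$ Moreover, the path is the only maximizer and the star is the only minimizer: equality in either of the two upper bounds holds if and only if $T$ is isomorphic to $P_n$, and equality in either of the two lower bounds holds if and only if $T$ is isomorphic to $S_n$. -/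

import Mathlib

open MeasureTheory ProbabilityTheory
open scoped ENNReal

namespace SimpleGraph

open Classical in
/-- The one-step law of the simple random walk at `u`: a uniformly random neighbour of `u`.
A vertex without neighbours, where there is no neighbour to choose, is taken to be absorbing;
in a connected graph this only concerns the graph with one vertex. -/
noncomputable def walkStep {V : Type*} [Fintype V] (G : SimpleGraph V) (u : V) : PMF V :=
  if h : (Finset.univ.filter (G.Adj u)).Nonempty then
    PMF.uniformOfFinset (Finset.univ.filter (G.Adj u)) h
  else PMF.pure u

/-- The one-step law of the simple random walk as a Markov kernel. -/
noncomputable def walkKernel {V : Type*} [Fintype V] [MeasurableSpace V]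
    [DiscreteMeasurableSpace V] (G : SimpleGraph V) : Kernel V V where
  toFun u := (G.walkStep u).toMeasure
  measurable' := Measurable.of_discrete

instance {V : Type*} [Fintype V] [MeasurableSpace V] [DiscreteMeasurableSpace V]
    (G : SimpleGraph V) : IsMarkovKernel G.walkKernel :=
  ⟨fun u => inferInstanceAs (IsProbabilityMeasure (G.walkStep u).toMeasure)⟩

/-- The law, on the space of trajectories `ℕ → V`, of the simple random walk on `G` started
at `u`. -/
noncomputable def walkLaw {V : Type*} [Fintype V] [MeasurableSpace V]
    [DiscreteMeasurableSpace V] (G : SimpleGraph V) (u : V) : Measure (ℕ → V) :=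
  Kernel.traj (X := fun _ => V)
    (fun n => G.walkKernel.comap
      (fun x : (Finset.Iic n → V) => x ⟨n, Finset.mem_Iic.2 le_rfl⟩) (measurable_pi_apply _))
    0 (fun _ => u)

/-- The hitting time `H_G(u, v)`: the expectation of the first time `t ≥ 0` at which the simple
random walk started at `u` is at `v` (this time is `∞` on trajectories that never visit `v`). -/
noncomputable def hittingTime {V : Type*} [Fintype V] (G : SimpleGraph V) (u v : V) : ℝ≥0∞ :=
  letI : MeasurableSpace V := ⊤
  ∫⁻ ω, ENat.toENNReal (hittingAfter (fun (t : ℕ) (ω : ℕ → V) => ω t) {v} 0 ω) ∂(G.walkLaw u)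

/-- The average hitting time `α(G) = |V|⁻² ∑ u, ∑ v, H_G(u, v)`. -/
noncomputable def averageHittingTime {V : Type*} [Fintype V] (G : SimpleGraph V) : ℝ≥0∞ :=
  (∑ u, ∑ v, G.hittingTime u v) / (Fintype.card V : ℝ≥0∞) ^ 2

/-- `π` is a stationary distribution of the simple random walk: `πᵀ P = πᵀ`. -/
def IsStationary {V : Type*} [Fintype V] (G : SimpleGraph V) (π : PMF V) : Prop :=
  ∀ v, ∑ u, π u * G.walkStep u v = π v

theorem exists_isStationary {V : Type*} [Fintype V] [Nonempty V] (G : SimpleGraph V) :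
    ∃ π : PMF V, G.IsStationary π := by
  classical
  by_cases hE : ∃ u v, G.Adj u v
  · let d : V → ℝ≥0∞ := fun u => ((Finset.univ.filter (G.Adj u)).card : ℝ≥0∞)
    have h0 : tsum d ≠ 0 := by
      obtain ⟨u, v, huv⟩ := hE
      intro h
      have h1 := ENNReal.tsum_eq_zero.1 h u
      have h2 : (Finset.univ.filter (G.Adj u)).card = 0 := by exact_mod_cast h1
      have h3 : v ∈ Finset.univ.filter (G.Adj u) := by simpa using huv
      rw [Finset.card_eq_zero] at h2
      rw [h2] at h3
      simp at h3
    have htop : tsum d ≠ ⊤ := by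
      rw [tsum_fintype]
      exact ENNReal.sum_ne_top.2 fun u _ => ENNReal.natCast_ne_top _
    refine ⟨PMF.normalize d h0 htop, fun v => ?_⟩
    have key : ∀ u, d u * G.walkStep u v = if G.Adj v u then 1 else 0 := by
      intro u
      by_cases hne : (Finset.univ.filter (G.Adj u)).Nonempty
      · have hc : d u ≠ 0 := by
          simp only [d]
          exact_mod_cast (Finset.card_pos.2 hne).ne'
        rw [walkStep, dif_pos hne, PMF.uniformOfFinset_apply]
        by_cases ha : G.Adj u v
        · simp only [Finset.mem_filter, Finset.mem_univ, true_and, ha, if_true, ha.symm]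
          exact ENNReal.mul_inv_cancel hc (ENNReal.natCast_ne_top _)
        · have ha' : ¬ G.Adj v u := fun h => ha h.symm
          simp [ha, ha']
      · have hz : d u = 0 := by
          simp only [d]
          rw [Finset.not_nonempty_iff_eq_empty.1 hne]
          simp
        have ha' : ¬ G.Adj v u := fun h => hne ⟨v, by simpa using h.symm⟩
        simp [hz, ha']
    calc ∑ u, PMF.normalize d h0 htop u * G.walkStep u v
        = ∑ u, (d u * G.walkStep u v) * (tsum d)⁻¹ := by
          refine Finset.sum_congr rfl fun u _ => ?_
          rw [PMF.normalize_apply]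
          ring
      _ = d v * (tsum d)⁻¹ := by
          rw [← Finset.sum_mul]
          simp [key, d]
      _ = PMF.normalize d h0 htop v := by rw [PMF.normalize_apply]
  · refine ⟨PMF.pure (Classical.arbitrary V), fun v => ?_⟩
    have hs : ∀ u, G.walkStep u = PMF.pure u := by
      intro u
      rw [walkStep, dif_neg]
      rintro ⟨w, hw⟩
      exact hE ⟨u, w, by simpa using hw⟩
    simp [hs, PMF.pure_apply]

/-- The stationary distribution of the simple random walk (it is unique if `G` is connected). -/
noncomputable def stationary {V : Type*} [Fintype V] [Nonempty V] (G : SimpleGraph V) : PMF V :=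
  G.exists_isStationary.choose

/-- Kemeny's constant `κ(G) = ∑ v, H_G(u, v) π_G(v)`, computed from the starting vertex `u`. -/
noncomputable def kemeny {V : Type*} [Fintype V] (G : SimpleGraph V) (u : V) : ℝ≥0∞ :=
  haveI : Nonempty V := ⟨u⟩
  ∑ v, G.hittingTime u v * G.stationary v

end SimpleGraph

/-! For trees on `n` vertices both quantities are increasing functions of `totalDist`, the sum W of
all distances: α = (n - 1) W / n², and κ = W / (n - 1) - n + 1/2 when n ≥ 2. The source is the
Laplacian of the distance: in a tree exactly one neighbour of u ≠ w is closer to w, so ∑_{x ~ u}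
(d(x,w) - d(u,w)) = deg u - 2 + 2·[u = w]. Hence `treeHit` solves the first-step equations, and a
finite nonnegative solution of these is the hitting time (`hittingTime_eq_of_firstStep`). It remains
to find the extremes of W. Path: delete a non-cut vertex and bound the distances to it
(`Connected.three_mul_totalDist_add_card_le`). Star: pairs that are neither equal nor adjacent have
distance at least 2 (`IsTree.le_totalDist`). -/

/-- Tail-sum formula, infinite values included; `p k` will be "not yet hit at time `k`". -/
theorem ENat.toENNReal_eq_tsum {n : ℕ∞} {p : ℕ → Prop} [DecidablePred p]
    (h : ∀ k : ℕ, n ≤ k ↔ ¬ p k) :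
    ENat.toENNReal n = ∑' k : ℕ, if p k then (1 : ℝ≥0∞) else 0 := by
  induction n using ENat.recTopCoe with
  | top =>
    have : ∀ k, p k := fun k => not_not.1 fun hk => by simpa using (h k).2 hk
    simp [this]
  | coe n =>
    have hp : ∀ k, p k ↔ k < n := fun k => by
      rw [← not_iff_not, ← h k]
      simp
    rw [tsum_eq_sum (s := Finset.range n)]
    · rw [Finset.sum_congr rfl (g := fun _ => 1)]
      · simp
      · intro k hk
        simpa [hp] using hk
    · intro k hk
      simpa [hp] using hk

namespace SimpleGraph

theorem measurable_survival {V : Type*} [MeasurableSpace V] [DiscreteMeasurableSpace V]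
    (v : V) (k : ℕ) (f : V → ℝ≥0∞)
    [DecidablePred fun ω : ℕ → V => ∀ i ≤ k, ω i ≠ v] :
    Measurable (fun ω : ℕ → V => if ∀ i ≤ k, ω i ≠ v then f (ω k) else 0) := by
  refine Measurable.ite ?_ (Measurable.of_discrete.comp (measurable_pi_apply k))
    measurable_const
  have : {ω : ℕ → V | ∀ i ≤ k, ω i ≠ v} = ⋂ i ≤ k, (fun ω : ℕ → V => ω i) ⁻¹' {v}ᶜ := by
    ext ω
    simp
  rw [this]
  exact MeasurableSet.iInter fun i => MeasurableSet.iInter fun _ =>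
    measurable_pi_apply i (.of_discrete)

/-! ### Hitting times as solutions of the first-step equations -/

section Hitting

variable {V : Type*} [Fintype V] [MeasurableSpace V] [DiscreteMeasurableSpace V]

theorem lintegral_walkKernel (G : SimpleGraph V) (u : V) (f : V → ℝ≥0∞) :
    ∫⁻ w, f w ∂(G.walkKernel u) = ∑ w, G.walkStep u w * f w := by
  rw [lintegral_fintype]
  refine Finset.sum_congr rfl fun w _ => ?_
  rw [mul_comm]
  congr 1
  exact PMF.toMeasure_apply_singleton _ _ (measurableSet_singleton _)

instance (G : SimpleGraph V) (u : V) : IsProbabilityMeasure (G.walkLaw u) := by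
  unfold walkLaw
  infer_instance

theorem map_walkLaw_frestrictLe_prod (G : SimpleGraph V) (u : V) (k : ℕ) :
    (G.walkLaw u).map (fun ω => (Preorder.frestrictLe k ω, ω (k + 1))) =
      (G.walkLaw u).map (Preorder.frestrictLe k) ⊗ₘ
        (G.walkKernel.comap
          (fun x : (Finset.Iic k → V) => x ⟨k, Finset.mem_Iic.2 le_rfl⟩)
          (measurable_pi_apply _)) := by
  unfold walkLaw
  rw [Kernel.traj_map_frestrictLe_apply]
  exact (Kernel.partialTraj_compProd_eq_map_traj (X := fun _ => V) (Nat.zero_le k)).symm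

/-- Markov property. `F` may see the whole past, so that it can carry the event of not having met
`v`. -/
theorem lintegral_walkLaw_succ (G : SimpleGraph V) (u : V) (k : ℕ)
    (F : (Finset.Iic k → V) → V → ℝ≥0∞) :
    ∫⁻ ω, F (Preorder.frestrictLe k ω) (ω (k + 1)) ∂(G.walkLaw u) =
      ∫⁻ ω, ∑ w, G.walkStep (ω k) w * F (Preorder.frestrictLe k ω) w ∂(G.walkLaw u) := by
  have hF : Measurable (fun p : (Finset.Iic k → V) × V => F p.1 p.2) := Measurable.of_discrete
  have h1 := lintegral_map (μ := G.walkLaw u) hF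
    (g := fun ω => (Preorder.frestrictLe k ω, ω (k + 1))) (by fun_prop)
  rw [← h1, map_walkLaw_frestrictLe_prod, Measure.lintegral_compProd hF,
    lintegral_map Measurable.of_discrete (by fun_prop)]
  refine lintegral_congr fun ω => ?_
  rw [Kernel.comap_apply, lintegral_walkKernel]
  rfl

theorem lintegral_walkLaw_zero (G : SimpleGraph V) (u : V) (f : V → ℝ≥0∞) :
    ∫⁻ ω, f (ω 0) ∂(G.walkLaw u) = f u := by
  have h := Kernel.traj_map_frestrictLe_apply (X := fun _ => V)
    (κ := fun n => G.walkKernel.comap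
      (fun x : (Finset.Iic n → V) => x ⟨n, Finset.mem_Iic.2 le_rfl⟩) (measurable_pi_apply _))
    0 0 (fun _ => u)
  have h1 := lintegral_map (μ := G.walkLaw u)
    (f := fun x : (Finset.Iic 0 → V) => f (x ⟨0, Finset.mem_Iic.2 le_rfl⟩))
    (g := Preorder.frestrictLe 0) Measurable.of_discrete (by fun_prop)
  change _ = ∫⁻ ω, f (ω 0) ∂(G.walkLaw u) at h1
  rw [← h1]
  unfold walkLaw
  rw [h, Kernel.partialTraj_self, Kernel.id_apply, lintegral_dirac' _ Measurable.of_discrete]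

open Classical in
/-- The expectation of `f` at time `k`, on the event that `v` was not visited up to time `k`. -/
noncomputable def survivalMean (G : SimpleGraph V) (u v : V) (k : ℕ) (f : V → ℝ≥0∞) : ℝ≥0∞ :=
  ∫⁻ ω, (if ∀ i ≤ k, ω i ≠ v then f (ω k) else 0) ∂(G.walkLaw u)

theorem survivalMean_zero (G : SimpleGraph V) (u v : V) {f : V → ℝ≥0∞} (hf : f v = 0) :
    G.survivalMean u v 0 f = f u := by
  classical
  rw [survivalMean, ← G.lintegral_walkLaw_zero u f]
  refine lintegral_congr fun ω => ?_
  simp only [Nat.le_zero, forall_eq]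
  split_ifs with h
  · rfl
  · rw [not_not.1 h, hf]

/-- As `f` vanishes at `v`, avoiding `v` at the last step need not be imposed, and the Markov
property applies to the event up to time `k`. -/
theorem survivalMean_succ (G : SimpleGraph V) (u v : V) (k : ℕ) {f : V → ℝ≥0∞} (hf : f v = 0) :
    G.survivalMean u v (k + 1) f =
      G.survivalMean u v k (fun x => ∑ w, G.walkStep x w * f w) := by
  classical
  have h := G.lintegral_walkLaw_succ u k
    (fun x y => if ∀ i, x i ≠ v then f y else 0)
  have hiff : ∀ ω : ℕ → V, (∀ i, Preorder.frestrictLe (π := fun _ => V) k ω i ≠ v) ↔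
      ∀ i ≤ k, ω i ≠ v := by
    intro ω
    simp [Preorder.frestrictLe, Finset.restrict]
  simp only [hiff] at h
  rw [survivalMean, survivalMean]
  convert! h using 1
  · refine lintegral_congr fun ω => ?_
    by_cases h1 : ∀ i ≤ k, ω i ≠ v
    · by_cases h2 : ω (k + 1) = v
      · simp [h2, hf]
      · rw [if_pos h1, if_pos]
        intro i hi
        rcases Nat.le_succ_iff.1 hi with h3 | h3
        · exact h1 i h3
        · rwa [h3]
    · rw [if_neg h1, if_neg]
      exact fun h3 => h1 fun i hi => h3 i (hi.trans k.le_succ)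
  · refine lintegral_congr fun ω => ?_
    split_ifs <;> simp

theorem survivalMean_congr (G : SimpleGraph V) (u v : V) (k : ℕ) {f g : V → ℝ≥0∞}
    (h : ∀ x ≠ v, f x = g x) : G.survivalMean u v k f = G.survivalMean u v k g := by
  classical
  refine lintegral_congr fun ω => ?_
  split_ifs with h1
  · exact h _ (h1 k le_rfl)
  · rfl

theorem survivalMean_add (G : SimpleGraph V) (u v : V) (k : ℕ) (f g : V → ℝ≥0∞) :
    G.survivalMean u v k (fun x => f x + g x) =
      G.survivalMean u v k f + G.survivalMean u v k g := by
  classical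
  rw [survivalMean, survivalMean, survivalMean, ← lintegral_add_left (measurable_survival v k f)]
  refine lintegral_congr fun ω => ?_
  split_ifs <;> simp

theorem survivalMean_le (G : SimpleGraph V) (u v : V) (k : ℕ) (f : V → ℝ≥0∞) (C : ℝ≥0∞)
    (h : ∀ x, f x ≤ C) :
    G.survivalMean u v k f ≤ C * G.survivalMean u v k (fun _ => 1) := by
  classical
  rw [survivalMean, survivalMean, ← lintegral_const_mul _ (measurable_survival v k fun _ => 1)]
  refine lintegral_mono fun ω => ?_
  dsimp only
  split_ifs
  · simpa using h _
  · simp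

theorem lintegral_hittingAfter (G : SimpleGraph V) (u v : V) :
    ∫⁻ ω, ENat.toENNReal (hittingAfter (fun (t : ℕ) (ω : ℕ → V) => ω t) {v} 0 ω)
      ∂(G.walkLaw u) = ∑' k, G.survivalMean u v k (fun _ => 1) := by
  classical
  simp only [survivalMean]
  rw [← lintegral_tsum fun k => (measurable_survival v k fun _ => 1).aemeasurable]
  refine lintegral_congr fun ω => ?_
  refine ENat.toENNReal_eq_tsum fun k => ?_
  refine (hittingAfter_le_iff (u := fun (t : ℕ) (ω : ℕ → V) => ω t)).trans ?_
  simp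

/-- A finite solution of the first-step equations is the vector of hitting times. -/
theorem lintegral_hittingAfter_eq_of_firstStep (G : SimpleGraph V) (v : V) (h : V → ℝ≥0∞)
    (hfin : ∀ x, h x ≠ ∞) (hv : h v = 0)
    (hstep : ∀ x ≠ v, h x = 1 + ∑ w, G.walkStep x w * h w) (u : V) :
    ∫⁻ ω, ENat.toENNReal (hittingAfter (fun (t : ℕ) (ω : ℕ → V) => ω t) {v} 0 ω)
      ∂(G.walkLaw u) = h u := by
  rw [lintegral_hittingAfter]
  -- The first-step equation iterated `K` times: a truncated expectation plus the mean of `h` over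
  -- the surviving walks.
  have hsum : ∀ K, h u = ∑ k ∈ Finset.range K, G.survivalMean u v k (fun _ => 1) +
      G.survivalMean u v K h := by
    intro K
    induction K with
    | zero => simp [survivalMean_zero _ _ _ hv]
    | succ K ih =>
      rw [ih, Finset.sum_range_succ, add_assoc, G.survivalMean_succ u v K hv,
        ← survivalMean_add, ← survivalMean_congr G u v K hstep]
  have hle : ∑' k, G.survivalMean u v k (fun _ => 1) ≤ h u := by
    rw [ENNReal.tsum_eq_iSup_nat]
    exact iSup_le fun K => (hsum K).symm ▸ le_self_add
  have hne : ∑' k, G.survivalMean u v k (fun _ => 1) ≠ ∞ := ne_top_of_le_ne_top (hfin u) hle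
  have h0 := ENNReal.tendsto_atTop_zero_of_tsum_ne_top hne
  have hC : ∑ x, h x ≠ ∞ := ENNReal.sum_ne_top.2 fun x _ => hfin x
  -- The survival probabilities are terms of a series bounded by `h u`, so they tend to 0; no
  -- separate recurrence argument is needed.
  have h1 : Filter.Tendsto (fun K => G.survivalMean u v K h) Filter.atTop (nhds 0) := by
    refine tendsto_of_tendsto_of_tendsto_of_le_of_le tendsto_const_nhds
      (by simpa using ENNReal.Tendsto.const_mul h0 (Or.inr hC)) (fun _ => zero_le) fun K =>
      G.survivalMean_le u v K h (∑ x, h x) fun x =>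
        Finset.single_le_sum (f := h) (fun _ _ => zero_le) (Finset.mem_univ x)
  have h2 := (ENNReal.tendsto_nat_tsum
    (fun k => G.survivalMean u v k (fun _ => 1))).add h1
  rw [add_zero] at h2
  exact tendsto_nhds_unique h2 (by simp only [← hsum]; exact tendsto_const_nhds)

end Hitting

/-- A finite solution of the first-step equations is the vector of hitting times. -/
theorem hittingTime_eq_of_firstStep {V : Type*} [Fintype V] (G : SimpleGraph V) (v : V)
    (h : V → ℝ≥0∞) (hfin : ∀ x, h x ≠ ∞) (hv : h v = 0)
    (hstep : ∀ x ≠ v, h x = 1 + ∑ w, G.walkStep x w * h w) (u : V) :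
    G.hittingTime u v = h u := by
  let _ : MeasurableSpace V := ⊤
  exact G.lintegral_hittingAfter_eq_of_firstStep v h hfin hv hstep u

end SimpleGraph

namespace SimpleGraph

/-! ### Distances in trees and their Laplacian -/

section Distances

variable {V : Type*} {G : SimpleGraph V}

theorem Connected.exists_adj_dist_succ (hG : G.Connected) {u w : V} (h : u ≠ w) :
    ∃ x, G.Adj u x ∧ G.dist u w = G.dist x w + 1 := by
  obtain ⟨p, hp⟩ := hG.exists_walk_length_eq_dist u w
  cases p with
  | nil => exact absurd rfl h
  | @cons _ x _ hux q =>
    refine ⟨x, hux, ?_⟩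
    have h1 := dist_le q
    have h2 := hG.dist_triangle (u := u) (v := x) (w := w)
    rw [dist_eq_one_iff_adj.2 hux] at h2
    rw [Walk.length_cons] at hp
    omega

/-- Two such neighbours would start two different geodesics, hence two paths, from `u` to `w`. -/
theorem IsTree.existsUnique_adj_dist_succ (hG : G.IsTree) {u w : V} (h : u ≠ w) :
    ∃! x, G.Adj u x ∧ G.dist u w = G.dist x w + 1 := by
  obtain ⟨x, hx, hxd⟩ := hG.connected.exists_adj_dist_succ h
  refine ⟨x, ⟨hx, hxd⟩, ?_⟩
  rintro y ⟨hy, hyd⟩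
  obtain ⟨p, hp⟩ := hG.connected.exists_walk_length_eq_dist x w
  obtain ⟨q, hq⟩ := hG.connected.exists_walk_length_eq_dist y w
  have h1 : (Walk.cons hx p).IsPath :=
    Walk.isPath_of_length_eq_dist _ (by rw [Walk.length_cons, hp, hxd])
  have h2 : (Walk.cons hy q).IsPath :=
    Walk.isPath_of_length_eq_dist _ (by rw [Walk.length_cons, hq, hyd])
  have h3 := congrArg (fun r : G.Path u w => r.1.snd)
    ((hG.isAcyclic.subsingleton_path u w).elim ⟨_, h2⟩ ⟨_, h1⟩)
  simpa using h3

theorem Connected.dist_hom_le {W : Type*} {H : SimpleGraph W} (hG : G.Connected) (f : G →g H)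
    (u v : V) :
    H.dist (f u) (f v) ≤ G.dist u v := by
  obtain ⟨p, hp⟩ := hG.exists_walk_length_eq_dist u v
  rw [← hp, ← Walk.length_map f]
  exact dist_le _

end Distances

section Laplacian

variable {V : Type*} [Fintype V] {G : SimpleGraph V} [DecidableRel G.Adj]

theorem sum_sum_neighborFinset_comm (F : V → V → ℝ) :
    ∑ u, ∑ x ∈ G.neighborFinset u, F u x = ∑ u, ∑ x ∈ G.neighborFinset u, F x u := by
  refine Finset.sum_comm' fun x y => ?_
  simp [G.adj_comm]

theorem sum_neighborFinset_sub_eq_zero (f : V → ℝ) :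
    ∑ u, ∑ x ∈ G.neighborFinset u, (f x - f u) = 0 := by
  simp only [Finset.sum_sub_distrib]
  rw [sum_sum_neighborFinset_comm (fun u x => f x), sub_self]

variable [DecidableEq V]

/-- One neighbour contributes -1 and the others +1; at `u = w` all contribute +1. -/
theorem IsTree.sum_neighborFinset_dist_sub (hG : G.IsTree) (u w : V) :
    ∑ x ∈ G.neighborFinset u, ((G.dist x w : ℝ) - G.dist u w) =
      G.degree u - 2 + if u = w then 2 else 0 := by
  by_cases h : u = w
  · subst h
    rw [Finset.sum_congr rfl (g := fun _ => (1 : ℝ))]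
    · simp
    · intro x hx
      rw [mem_neighborFinset] at hx
      rw [dist_eq_one_iff_adj.2 hx.symm, dist_self]
      simp
  · obtain ⟨y, ⟨hy, hyd⟩, huniq⟩ := hG.existsUnique_adj_dist_succ h
    rw [Finset.sum_congr rfl (g := fun x => (1 : ℝ) - if x = y then 2 else 0)]
    · simp [h, hy]
    · intro x hx
      rw [mem_neighborFinset] at hx
      have h1 := hG.dist_eq_dist_add_one_of_adj w hx
      rw [dist_comm, dist_comm (u := w) (v := x)] at h1
      split_ifs with hxy
      · subst hxy
        rw [hyd]
        push_cast
        ring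
      · rcases h1 with h1 | h1
        · exact absurd (huniq x ⟨hx, h1⟩) hxy
        · rw [h1]
          push_cast
          ring

theorem IsTree.sum_degree_real (hG : G.IsTree) :
    ∑ u, (G.degree u : ℝ) = 2 * (Fintype.card V - 1) := by
  obtain ⟨w⟩ := hG.connected.nonempty
  have h := sum_neighborFinset_sub_eq_zero (G := G) (fun u => (G.dist u w : ℝ))
  simp only [hG.sum_neighborFinset_dist_sub, Finset.sum_add_distrib, Finset.sum_sub_distrib] at h
  simp at h
  linarith

/-- The Laplacian of the squared distance sums to zero, and (d ± 1)² - d² = ±2d + 1 reduces it to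
the Laplacian of d. -/
theorem IsTree.sum_degree_mul_dist (hG : G.IsTree) (w : V) :
    ∑ u, (G.degree u : ℝ) * G.dist u w = 2 * ∑ u, (G.dist u w : ℝ) - (Fintype.card V - 1) := by
  have h := sum_neighborFinset_sub_eq_zero (G := G) (fun u => (G.dist u w : ℝ) ^ 2)
  have h1 : ∀ u, ∑ x ∈ G.neighborFinset u, ((G.dist x w : ℝ) ^ 2 - (G.dist u w : ℝ) ^ 2) =
      2 * (G.degree u * G.dist u w) - 4 * G.dist u w + G.degree u := by
    intro u
    have h2 : ∀ x ∈ G.neighborFinset u, (G.dist x w : ℝ) ^ 2 - (G.dist u w : ℝ) ^ 2 =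
        2 * G.dist u w * ((G.dist x w : ℝ) - G.dist u w) + 1 := by
      intro x hx
      rw [mem_neighborFinset] at hx
      have h1 := hG.dist_eq_dist_add_one_of_adj w hx
      rw [dist_comm, dist_comm (u := w) (v := x)] at h1
      rcases h1 with h1 | h1 <;> rw [h1] <;> push_cast <;> ring
    rw [Finset.sum_congr rfl h2, Finset.sum_add_distrib, ← Finset.mul_sum,
      hG.sum_neighborFinset_dist_sub]
    by_cases huw : u = w
    · subst huw
      simp
    · simp [huw]
      ring
  simp only [h1, Finset.sum_add_distrib, Finset.sum_sub_distrib, ← Finset.mul_sum,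
    hG.sum_degree_real] at h
  linarith

end Laplacian

/-- The sum of the distances of all ordered pairs of vertices, twice the Wiener index. -/
noncomputable def totalDist {V : Type*} [Fintype V] (G : SimpleGraph V) : ℕ :=
  ∑ u, ∑ v, G.dist u v

/-! ### Hitting times on trees -/

section HittingTime

variable {V : Type*} [Fintype V] (G : SimpleGraph V) [DecidableRel G.Adj]

/-- The hitting time of the walk on a tree, in terms of distances. -/
noncomputable def treeHit (u v : V) : ℝ :=
  (∑ w, (G.degree w : ℝ) * ((G.dist u v : ℝ) + G.dist v w - G.dist u w)) / 2

variable {G}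

theorem treeHit_self (v : V) : G.treeHit v v = 0 := by simp [treeHit]

theorem Connected.treeHit_nonneg (hG : G.Connected) (u v : V) : 0 ≤ G.treeHit u v := by
  refine div_nonneg (Finset.sum_nonneg fun w _ => mul_nonneg (Nat.cast_nonneg _) ?_) two_pos.le
  have := hG.dist_triangle (u := u) (v := v) (w := w)
  have : (G.dist u w : ℝ) ≤ G.dist u v + G.dist v w := by exact_mod_cast this
  linarith

/-- The Laplacians of d(·, v) and d(·, w) at `u` cancel except for `w = u`, where the difference is
-2; the weight `G.degree w` and the factor 1/2 turn this into `-G.degree u`. -/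
theorem IsTree.treeHit_firstStep (hG : G.IsTree) {u v : V} (h : u ≠ v) :
    (G.degree u : ℝ) * G.treeHit u v =
      G.degree u + ∑ x ∈ G.neighborFinset u, G.treeHit x v := by
  classical
  have h1 : ∑ x ∈ G.neighborFinset u, (G.treeHit x v - G.treeHit u v) = -G.degree u := by
    have h2 : ∀ x, G.treeHit x v - G.treeHit u v = (∑ w, (G.degree w : ℝ) *
        (((G.dist x v : ℝ) - G.dist u v) - (G.dist x w - G.dist u w))) / 2 := by
      intro x
      rw [treeHit, treeHit, ← sub_div, ← Finset.sum_sub_distrib]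
      congr 1
      refine Finset.sum_congr rfl fun w _ => ?_
      ring
    simp only [h2]
    rw [← Finset.sum_div, Finset.sum_comm]
    simp only [← Finset.mul_sum, Finset.sum_sub_distrib (f := fun x => (G.dist x v : ℝ) - _),
      hG.sum_neighborFinset_dist_sub, if_neg h]
    have h3 : ∀ w, (G.degree w : ℝ) * ((G.degree u : ℝ) - 2 + 0 -
        ((G.degree u : ℝ) - 2 + if u = w then 2 else 0)) =
        if u = w then (G.degree w : ℝ) * (-2) else 0 := by
      intro w
      split_ifs <;> ring
    simp only [h3]
    simp
    ring
  rw [Finset.sum_sub_distrib] at h1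
  simp at h1
  linarith

theorem Connected.degree_pos_of_ne (hG : G.Connected) {u v : V} (h : u ≠ v) :
    0 < G.degree u := by
  obtain ⟨x, hx, -⟩ := hG.exists_adj_dist_succ h
  exact (G.degree_pos_iff_exists_adj u).2 ⟨x, hx⟩

theorem walkStep_apply_of_degree_pos {u : V} (h : 0 < G.degree u) (w : V) :
    G.walkStep u w = if G.Adj u w then ENNReal.ofReal (G.degree u : ℝ)⁻¹ else 0 := by
  classical
  obtain ⟨x, hx⟩ := (G.degree_pos_iff_exists_adj u).1 h
  have hne : (Finset.univ.filter (G.Adj u)).Nonempty := ⟨x, by simpa using hx⟩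
  have h2 : G.walkStep u = PMF.uniformOfFinset _ hne := by
    rw [walkStep]
    convert! dif_pos hne
    infer_instance
  rw [h2, PMF.uniformOfFinset_apply]
  have h1 : (Finset.univ.filter (G.Adj u)).card = G.degree u := by
    rw [← card_neighborFinset_eq_degree]
    congr 1
    ext y
    simp
  rw [ENNReal.ofReal_inv_of_pos (by exact_mod_cast h), ENNReal.ofReal_natCast, ← h1]
  simp

theorem IsTree.hittingTime_eq (hG : G.IsTree) (u v : V) :
    G.hittingTime u v = ENNReal.ofReal (G.treeHit u v) := by
  refine G.hittingTime_eq_of_firstStep v (fun x => ENNReal.ofReal (G.treeHit x v))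
    (fun _ => ENNReal.ofReal_ne_top) (by simp [treeHit_self]) (fun x hx => ?_) u
  have hd := hG.connected.degree_pos_of_ne hx
  have hd' : (0 : ℝ) < G.degree x := by exact_mod_cast hd
  simp only [walkStep_apply_of_degree_pos hd, ite_mul, zero_mul]
  rw [← Finset.sum_filter, ← neighborFinset_eq_filter, ← Finset.mul_sum,
    ← ENNReal.ofReal_sum_of_nonneg fun y _ => hG.connected.treeHit_nonneg y v,
    ← ENNReal.ofReal_mul (by positivity), ← ENNReal.ofReal_one, ← ENNReal.ofReal_add zero_le_one]
  · congr 1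
    have := hG.treeHit_firstStep hx
    field_simp
    rw [mul_comm]
    exact this
  · exact mul_nonneg (by positivity)
      (Finset.sum_nonneg fun y _ => hG.connected.treeHit_nonneg y v)

/-- For fixed w the sums of d(v,w) and d(u,w) over all u, v cancel, so each w contributes
`totalDist` weighted by half its degree. -/
theorem IsTree.sum_sum_treeHit (hG : G.IsTree) :
    ∑ u, ∑ v, G.treeHit u v = (Fintype.card V - 1) * G.totalDist := by
  classical
  have h1 : ∀ w, ∑ u, ∑ v, ((G.dist u v : ℝ) + G.dist v w - G.dist u w) = G.totalDist := by
    intro w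
    simp only [Finset.sum_sub_distrib, Finset.sum_add_distrib]
    rw [Finset.sum_comm (f := fun u v => (G.dist u w : ℝ))]
    simp [totalDist]
  calc ∑ u, ∑ v, G.treeHit u v
      = (∑ w, (G.degree w : ℝ) * ∑ u, ∑ v, ((G.dist u v : ℝ) + G.dist v w - G.dist u w)) / 2 := by
        simp only [treeHit, ← Finset.sum_div, Finset.mul_sum]
        exact congrArg (· / 2)
          ((Finset.sum_congr rfl fun u _ => Finset.sum_comm).trans Finset.sum_comm)
    _ = _ := by
        simp only [h1]
        rw [← Finset.sum_mul, hG.sum_degree_real]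
        ring

theorem IsTree.averageHittingTime_eq (hG : G.IsTree) :
    G.averageHittingTime =
      ENNReal.ofReal ((Fintype.card V - 1) * G.totalDist / (Fintype.card V : ℝ) ^ 2) := by
  have : Nonempty V := hG.connected.nonempty
  have hc : (0 : ℝ) < Fintype.card V := by exact_mod_cast Fintype.card_pos
  rw [averageHittingTime, ← hG.sum_sum_treeHit, ENNReal.ofReal_div_of_pos (by positivity),
    ENNReal.ofReal_pow (by positivity), ENNReal.ofReal_natCast,
    ENNReal.ofReal_sum_of_nonneg fun u _ =>
      Finset.sum_nonneg fun v _ => hG.connected.treeHit_nonneg u v]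
  refine congrArg (· / _) (Finset.sum_congr rfl fun u _ => ?_)
  rw [ENNReal.ofReal_sum_of_nonneg fun v _ => hG.connected.treeHit_nonneg u v]
  exact Finset.sum_congr rfl fun v _ => hG.hittingTime_eq u v

end HittingTime

/-! ### The stationary distribution and Kemeny's constant -/

section Stationary

variable {V : Type*} [Fintype V] {G : SimpleGraph V} [DecidableRel G.Adj]

/-- Maximum principle: the set where `g` is maximal is closed under taking neighbours. -/
theorem Connected.eq_of_harmonic (hG : G.Connected) (g : V → ℝ)
    (hg : ∀ u, ∑ x ∈ G.neighborFinset u, g x = G.degree u * g u) (u v : V) : g u = g v := by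
  have : Nonempty V := ⟨u⟩
  obtain ⟨m, hm⟩ := Finite.exists_max g
  have hstep : ∀ x y, G.Adj x y → g x = g m → g y = g m := by
    intro x y hxy hx
    have h1 : ∑ z ∈ G.neighborFinset x, (g m - g z) = 0 := by
      rw [Finset.sum_sub_distrib, hg x, hx]
      simp
    have h2 := (Finset.sum_eq_zero_iff_of_nonneg fun z _ => sub_nonneg.2 (hm z)).1 h1 y
      (by simpa using hxy)
    linarith
  have hwalk : ∀ {x y : V}, G.Walk x y → g x = g m → g y = g m := by
    intro x y p
    induction p with
    | nil => exact id
    | cons h _ ih => exact fun hx => ih (hstep _ _ h hx)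
  have hall : ∀ x, g x = g m := fun x => (hG m x).elim fun p => hwalk p rfl
  rw [hall u, hall v]

/-- Stationarity makes π / deg harmonic, hence constant. This identifies `stationary`, which is only
a chosen witness. -/
theorem Connected.isStationary_apply (hG : G.Connected) [Nontrivial V] {π : PMF V}
    (hπ : G.IsStationary π) (v : V) :
    π v = ENNReal.ofReal (G.degree v / ∑ u, (G.degree u : ℝ)) := by
  have hd : ∀ u, 0 < G.degree u := fun u =>
    (exists_ne u).elim fun w hw => hG.degree_pos_of_ne hw.symm
  have hd' : ∀ u, (0 : ℝ) < G.degree u := fun u => by exact_mod_cast hd u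
  have hfin : ∀ u, π u ≠ ∞ := fun u => π.apply_ne_top u
  have hst : ∀ u, ∑ x ∈ G.neighborFinset u, (π x).toReal / G.degree x = (π u).toReal := by
    intro u
    rw [← hπ u, ENNReal.toReal_sum fun x _ => ENNReal.mul_ne_top (hfin x)
      (PMF.apply_ne_top _ _)]
    rw [neighborFinset_eq_filter, Finset.sum_filter]
    refine Finset.sum_congr rfl fun x _ => ?_
    rw [walkStep_apply_of_degree_pos (hd x)]
    by_cases h : G.Adj u x
    · rw [if_pos h, if_pos h.symm, ENNReal.toReal_mul,
        ENNReal.toReal_ofReal (inv_nonneg.2 (hd' x).le), div_eq_mul_inv]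
    · rw [if_neg h, if_neg fun h' => h h'.symm, mul_zero, ENNReal.toReal_zero]
  have hconst := hG.eq_of_harmonic (fun x => (π x).toReal / G.degree x) (by
    intro u
    rw [hst u, mul_div_cancel₀ _ (hd' u).ne'])
  have hsum : ∑ u, (π u).toReal = 1 := by
    have := π.tsum_coe
    rw [tsum_fintype] at this
    rw [← ENNReal.toReal_sum fun x _ => hfin x, this, ENNReal.toReal_one]
  have h1 : ∀ u, (π u).toReal = G.degree u * ((π v).toReal / G.degree v) := by
    intro u
    rw [← hconst u v, mul_div_cancel₀ _ (hd' u).ne']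
  have h2 : (∑ u, (G.degree u : ℝ)) * ((π v).toReal / G.degree v) = 1 := by
    rw [Finset.sum_mul, ← hsum]
    exact Finset.sum_congr rfl fun u _ => (h1 u).symm
  have hpos : 0 < ∑ u, (G.degree u : ℝ) := Finset.sum_pos (fun u _ => hd' u) ⟨v, by simp⟩
  rw [← ENNReal.ofReal_toReal (hfin v)]
  congr 1
  have := hd' v
  field_simp at h2 ⊢
  linarith

/-- The second conjunct is needed because `ENNReal.ofReal` truncates negative numbers: comparing two
values requires the sign. -/
theorem IsTree.kemeny_eq (hG : G.IsTree) [Nontrivial V] (u : V) :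
    G.kemeny u =
      ENNReal.ofReal (G.totalDist / (Fintype.card V - 1) - Fintype.card V + 1 / 2) ∧
    0 ≤ (G.totalDist : ℝ) / (Fintype.card V - 1) - Fintype.card V + 1 / 2 := by
  classical
  have hn : (0 : ℝ) < Fintype.card V - 1 := by
    have : 1 < Fintype.card V := Fintype.one_lt_card
    have : (1 : ℝ) < Fintype.card V := by exact_mod_cast this
    linarith
  have hnn : ∀ v, 0 ≤ G.treeHit u v * (G.degree v / (2 * (Fintype.card V - 1) : ℝ)) := fun v =>
    mul_nonneg (hG.connected.treeHit_nonneg u v) (by positivity)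
  have hsum : ∑ v, G.treeHit u v * (G.degree v / (2 * (Fintype.card V - 1) : ℝ)) =
      G.totalDist / (Fintype.card V - 1) - Fintype.card V + 1 / 2 := by
    have hD : ∑ v, ∑ w, (G.dist v w : ℝ) = G.totalDist := by simp [totalDist]
    have hrow : ∀ w, ∑ v, (G.degree v : ℝ) * G.dist w v =
        2 * ∑ v, (G.dist w v : ℝ) - (Fintype.card V - 1) := by
      intro w
      simp only [dist_comm (u := w)]
      exact hG.sum_degree_mul_dist w
    -- The identity `hrow` is applied once in each variable.
    have hG2 : ∑ v, (G.degree v : ℝ) * ∑ w, (G.degree w : ℝ) * G.dist v w =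
        4 * G.totalDist - 2 * Fintype.card V * (Fintype.card V - 1) -
          2 * (Fintype.card V - 1) ^ 2 := by
      simp only [hrow, mul_sub, Finset.sum_sub_distrib, ← Finset.sum_mul, hG.sum_degree_real]
      have : ∑ v, (G.degree v : ℝ) * (2 * ∑ w, (G.dist v w : ℝ)) =
          2 * ∑ w, ∑ v, (G.degree v : ℝ) * G.dist w v := by
        rw [Finset.sum_comm, Finset.mul_sum]
        refine Finset.sum_congr rfl fun v _ => ?_
        rw [Finset.mul_sum, Finset.mul_sum, Finset.mul_sum]
        refine Finset.sum_congr rfl fun w _ => ?_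
        rw [dist_comm]
        ring
      rw [this]
      simp only [hrow, Finset.sum_sub_distrib, ← Finset.mul_sum, hD]
      simp
      ring
    -- The two terms involving distances from `u` cancel; this is the independence of the starting
    -- vertex.
    have hexp : ∑ v, G.treeHit u v * (G.degree v : ℝ) =
        (∑ v, (G.degree v : ℝ) * ∑ w, (G.degree w : ℝ) * G.dist v w) / 2 := by
      have h1 : ∀ v, G.treeHit u v * (G.degree v : ℝ) =
          ((G.degree v : ℝ) * G.dist u v * ∑ w, (G.degree w : ℝ) +
            (G.degree v : ℝ) * ∑ w, (G.degree w : ℝ) * G.dist v w -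
            (G.degree v : ℝ) * ∑ w, (G.degree w : ℝ) * G.dist u w) / 2 := by
        intro v
        simp only [treeHit, mul_sub, mul_add, Finset.sum_sub_distrib, Finset.sum_add_distrib,
          ← Finset.sum_mul]
        ring
      simp only [h1]
      rw [← Finset.sum_div, Finset.sum_sub_distrib, Finset.sum_add_distrib, ← Finset.sum_mul,
        ← Finset.sum_mul]
      ring
    simp only [← mul_div_assoc]
    rw [← Finset.sum_div, hexp, hG2]
    field_simp
    ring
  refine ⟨?_, hsum ▸ Finset.sum_nonneg fun v _ => hnn v⟩
  rw [← hsum, ENNReal.ofReal_sum_of_nonneg fun v _ => hnn v, kemeny]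
  refine Finset.sum_congr rfl fun v _ => ?_
  rw [ENNReal.ofReal_mul (hG.connected.treeHit_nonneg u v), hG.hittingTime_eq]
  have : Nonempty V := ⟨u⟩
  rw [← hG.sum_degree_real, ← hG.connected.isStationary_apply G.exists_isStationary.choose_spec]
  rfl

end Stationary

/-! ### Reduction of both comparisons to the sum of distances -/

section Comparison

variable {V W : Type*} [Fintype V] [Fintype W] {G : SimpleGraph V} {H : SimpleGraph W}

theorem totalDist_eq_zero [Subsingleton V] : G.totalDist = 0 := by
  simp only [totalDist]
  refine Finset.sum_eq_zero fun u _ => Finset.sum_eq_zero fun v _ => ?_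
  rw [Subsingleton.elim u v, dist_self]

theorem IsTree.averageHittingTime_lt_top (hG : G.IsTree) : G.averageHittingTime < ∞ := by
  classical
  rw [hG.averageHittingTime_eq]
  exact ENNReal.ofReal_lt_top

/-- One vertex is treated apart: there the factor n - 1 vanishes and cannot be cancelled. -/
theorem IsTree.averageHittingTime_le_iff (hG : G.IsTree) (hH : H.IsTree)
    (hcard : Fintype.card V = Fintype.card W) :
    G.averageHittingTime ≤ H.averageHittingTime ↔ G.totalDist ≤ H.totalDist := by
  classical
  rcases subsingleton_or_nontrivial V with hV | hV
  · have hW : Subsingleton W := Fintype.card_le_one_iff_subsingleton.1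
      (hcard ▸ Fintype.card_le_one_iff_subsingleton.2 hV)
    rw [hG.averageHittingTime_eq, hH.averageHittingTime_eq, totalDist_eq_zero, totalDist_eq_zero]
    simp
  · have hn : (1 : ℝ) < Fintype.card W := by
      rw [← hcard]
      exact_mod_cast Fintype.one_lt_card (α := V)
    have hn' : (0 : ℝ) < Fintype.card W - 1 := by linarith
    rw [hG.averageHittingTime_eq, hH.averageHittingTime_eq, hcard,
      ENNReal.ofReal_le_ofReal_iff (by positivity), div_le_div_iff_of_pos_right (by positivity),
      mul_le_mul_iff_right₀ hn', Nat.cast_le]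

theorem IsTree.kemeny_of_subsingleton [Subsingleton V] (hG : G.IsTree) (u : V) :
    G.kemeny u = 0 := by
  classical
  refine Finset.sum_eq_zero fun v _ => ?_
  rw [Subsingleton.elim u v, hG.hittingTime_eq, treeHit_self]
  simp

theorem IsTree.kemeny_lt_top (hG : G.IsTree) (u : V) : G.kemeny u < ∞ := by
  classical
  rcases subsingleton_or_nontrivial V with hV | hV
  · rw [hG.kemeny_of_subsingleton]
    exact ENNReal.zero_lt_top
  · rw [(hG.kemeny_eq u).1]
    exact ENNReal.ofReal_lt_top

/-- The starting vertices are arbitrary, so the case `G = H` also gives independence of the start.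
-/
theorem IsTree.kemeny_le_iff (hG : G.IsTree) (hH : H.IsTree)
    (hcard : Fintype.card V = Fintype.card W) (u : V) (w : W) :
    G.kemeny u ≤ H.kemeny w ↔ G.totalDist ≤ H.totalDist := by
  classical
  rcases subsingleton_or_nontrivial V with hV | hV
  · have hW : Subsingleton W := Fintype.card_le_one_iff_subsingleton.1
      (hcard ▸ Fintype.card_le_one_iff_subsingleton.2 hV)
    rw [hG.kemeny_of_subsingleton, hH.kemeny_of_subsingleton, totalDist_eq_zero,
      totalDist_eq_zero]
    simp
  · have hW : Nontrivial W := Fintype.one_lt_card_iff_nontrivial.1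
      (hcard ▸ Fintype.one_lt_card_iff_nontrivial.2 hV)
    have hn : (1 : ℝ) < Fintype.card W := by exact_mod_cast Fintype.one_lt_card (α := W)
    have hn' : (0 : ℝ) < Fintype.card W - 1 := by linarith
    rw [(hG.kemeny_eq u).1, (hH.kemeny_eq w).1, hcard,
      ENNReal.ofReal_le_ofReal_iff (hH.kemeny_eq w).2, add_le_add_iff_right,
      sub_le_sub_iff_right, div_le_div_iff_of_pos_right hn', Nat.cast_le]

theorem Iso.totalDist_eq (e : G ≃g H) (hG : G.Connected) (hH : H.Connected) :
    G.totalDist = H.totalDist := by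
  refine Fintype.sum_equiv e.toEquiv _ _ fun u => Fintype.sum_equiv e.toEquiv _ _ fun v => ?_
  refine le_antisymm ?_ (hG.dist_hom_le e.toHom u v)
  simpa using hH.dist_hom_le e.symm.toHom (e u) (e v)

end Comparison

end SimpleGraph

/-- A function whose values on a finite set form an initial segment of `ℕ` has the largest sum if
it is injective. -/
theorem Finset.two_mul_sum_add_card_le {α : Type*} (f : α → ℕ) (s : Finset α)
    (h : ∀ u ∈ s, ∀ j < f u, ∃ x ∈ s, f x = j) :
    2 * ∑ u ∈ s, f u + s.card ≤ s.card * s.card ∧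
      (2 * ∑ u ∈ s, f u + s.card = s.card * s.card → Set.InjOn f s) := by
  classical
  -- An element of largest value is never a witness for a smaller value, so removing it keeps the
  -- hypothesis.
  induction s using Finset.induction_on_max_value f with
  | empty => simp
  | insert a s ha hmax ih =>
    have h1 : ∀ u ∈ insert a s, ∀ j < f u, ∃ x ∈ s, f x = j := by
      intro u hu j hj
      obtain ⟨x, hx, hxj⟩ := h u hu j hj
      rcases Finset.mem_insert.1 hx with rfl | hx
      · rcases Finset.mem_insert.1 hu with rfl | hu
        · omega
        · have := hmax u hu
          omega
      · exact ⟨x, hx, hxj⟩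
    obtain ⟨ih1, ih2⟩ := ih fun u hu => h1 u (Finset.mem_insert_of_mem hu)
    have hsub : Finset.range (f a) ⊆ s.image f := by
      intro j hj
      obtain ⟨x, hx, hxj⟩ := h1 a (Finset.mem_insert_self a s) j (Finset.mem_range.1 hj)
      exact Finset.mem_image.2 ⟨x, hx, hxj⟩
    -- All values below `f a` are taken on `s`; in the equality case these are the only ones, so `f
    -- a` is a new value.
    have hcard : f a ≤ s.card := by
      simpa using (Finset.card_le_card hsub).trans Finset.card_image_le
    rw [Finset.sum_insert ha, Finset.card_insert_of_notMem ha]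
    refine ⟨by nlinarith, fun heq => ?_⟩
    have hfa : f a = s.card := by nlinarith
    have himage : Finset.range (f a) = s.image f :=
      Finset.eq_of_subset_of_card_le hsub (by simpa [hfa] using Finset.card_image_le)
    rw [Finset.coe_insert, Set.injOn_insert (by simpa using ha)]
    refine ⟨ih2 (by nlinarith), ?_⟩
    rintro ⟨u, hu, hua⟩
    have : f u ∈ Finset.range (f a) := himage ▸ Finset.mem_image_of_mem f hu
    rw [hua] at this
    exact lt_irrefl _ (Finset.mem_range.1 this)

namespace SimpleGraph

/-! ### The path maximizes the sum of distances -/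

section Path

variable {V : Type*} {G : SimpleGraph V}

theorem Connected.exists_dist_eq (hG : G.Connected) (u v : V) {j : ℕ} (hj : j < G.dist u v) :
    ∃ x, G.dist x v = j := by
  induction hk : G.dist u v generalizing u with
  | zero => omega
  | succ k ih =>
    have huv : u ≠ v := by
      rintro rfl
      simp at hk
    obtain ⟨x, -, hx⟩ := hG.exists_adj_dist_succ huv
    rcases (show j = k ∨ j < k by omega) with rfl | h
    · exact ⟨x, by omega⟩
    · exact ih x (by omega) (by omega)

theorem Connected.two_mul_sum_dist_add_card_le [Fintype V] (hG : G.Connected) (v : V) :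
    2 * ∑ u, G.dist u v + Fintype.card V ≤ Fintype.card V * Fintype.card V ∧
      (2 * ∑ u, G.dist u v + Fintype.card V = Fintype.card V * Fintype.card V →
        Function.Injective fun u => G.dist u v) := by
  have h := Finset.two_mul_sum_add_card_le (fun u => G.dist u v) Finset.univ fun u _ j hj => by
    simpa using hG.exists_dist_eq u v hj
  rw [Finset.coe_univ, Set.injOn_univ] at h
  exact h

/-- The distance to `v` is the isomorphism: each layer is a single vertex, a geodesic step joins
consecutive layers, and an edge changes the distance by at most one. -/
theorem Connected.nonempty_iso_pathGraph [Fintype V] (hG : G.Connected) {v : V}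
    (hinj : Function.Injective fun u => G.dist u v) :
    Nonempty (G ≃g pathGraph (Fintype.card V)) := by
  classical
  have hlt : ∀ u, G.dist u v < Fintype.card V := by
    intro u
    have hsub : Finset.range (G.dist u v + 1) ⊆ Finset.univ.image fun u => G.dist u v := by
      intro j hj
      rcases Nat.lt_succ_iff_lt_or_eq.1 (Finset.mem_range.1 hj) with h | rfl
      · simpa using hG.exists_dist_eq u v h
      · simp
    simpa using (Finset.card_le_card hsub).trans Finset.card_image_le
  have hbij : Function.Bijective fun u => (⟨G.dist u v, hlt u⟩ : Fin (Fintype.card V)) := by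
    rw [Fintype.bijective_iff_injective_and_card]
    refine ⟨fun x y hxy => hinj ?_, by simp⟩
    simpa using hxy
  have hstep : ∀ x y, G.dist x v + 1 = G.dist y v → G.Adj x y := by
    intro x y hxy
    have hyv : y ≠ v := by
      rintro rfl
      simp at hxy
    obtain ⟨z, hz, hzd⟩ := hG.exists_adj_dist_succ hyv
    have : z = x := hinj (show G.dist z v = G.dist x v by omega)
    exact this ▸ hz.symm
  refine ⟨⟨Equiv.ofBijective _ hbij, fun {x y} => ?_⟩⟩
  rw [pathGraph_adj]
  change G.dist x v + 1 = G.dist y v ∨ G.dist y v + 1 = G.dist x v ↔ _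
  refine ⟨fun h => h.elim (hstep x y) fun h => (hstep y x h).symm, fun h => ?_⟩
  have h1 := h.diff_dist_adj (u := v)
  have h2 : G.dist x v ≠ G.dist y v := fun h2 => h.ne (hinj h2)
  rw [dist_comm, dist_comm (u := v) (v := x)] at h1
  omega

theorem sum_eq_add_sum_compl_singleton [Fintype V] (v : V) [Fintype ({v}ᶜ : Set V)]
    (f : V → ℕ) : ∑ u, f u = f v + ∑ u : ({v}ᶜ : Set V), f u := by
  classical
  rw [← Finset.add_sum_erase _ _ (Finset.mem_univ v)]
  congr 1
  exact Finset.sum_subtype _ (by simp) f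

/-- Deleting `v` cannot shorten the distances between the remaining vertices. -/
theorem Connected.totalDist_le_add [Fintype V] (v : V) [Fintype ({v}ᶜ : Set V)]
    (hv : (G.induce {v}ᶜ).Connected) :
    G.totalDist ≤ (G.induce {v}ᶜ).totalDist + 2 * ∑ u, G.dist u v := by
  have h1 : ∑ u : ({v}ᶜ : Set V), ∑ w : ({v}ᶜ : Set V), G.dist u w ≤
      (G.induce {v}ᶜ).totalDist :=
    Finset.sum_le_sum fun u _ => Finset.sum_le_sum fun w _ =>
      hv.dist_hom_le (Embedding.induce {v}ᶜ).toHom u w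
  have h2 := sum_eq_add_sum_compl_singleton v fun u => G.dist u v
  have h3 : G.totalDist = ∑ w, G.dist v w +
      ∑ u : ({v}ᶜ : Set V), (G.dist u v + ∑ w : ({v}ᶜ : Set V), G.dist u w) := by
    rw [totalDist, sum_eq_add_sum_compl_singleton v fun u => ∑ w, G.dist u w]
    congr 1
    exact Finset.sum_congr rfl fun u _ => sum_eq_add_sum_compl_singleton v _
  have h4 : ∑ w, G.dist v w = ∑ w, G.dist w v := Finset.sum_congr rfl fun w _ => dist_comm
  rw [Finset.sum_add_distrib] at h3
  simp only [dist_self] at h2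
  omega

/-- Among the connected graphs of a given order, paths have the largest sum of distances. -/
theorem Connected.three_mul_totalDist_add_card_le {V : Type*} [Fintype V] {G : SimpleGraph V}
    (hG : G.Connected) :
    3 * G.totalDist + Fintype.card V ≤ Fintype.card V ^ 3 ∧
      (3 * G.totalDist + Fintype.card V = Fintype.card V ^ 3 →
        Nonempty (G ≃g pathGraph (Fintype.card V))) := by
  classical
  induction hn : Fintype.card V generalizing V with
  | zero =>
    have := hG.nonempty
    exact absurd hn Fintype.card_ne_zero
  | succ m ih =>
    rw [← hn]
    rcases subsingleton_or_nontrivial V with hV | hV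
    · obtain ⟨v⟩ := hG.nonempty
      have hc : Fintype.card V = 1 :=
        le_antisymm (Fintype.card_le_one_iff_subsingleton.2 hV) (by omega)
      refine ⟨by simp [totalDist_eq_zero, hc], fun _ => ?_⟩
      exact hG.nonempty_iso_pathGraph (v := v) (Function.injective_of_subsingleton _)
    · obtain ⟨v, hv⟩ := hG.exists_connected_induce_compl_singleton_of_finite_nontrivial
      have hc : Fintype.card ({v}ᶜ : Set V) = m := by
        rw [Fintype.card_compl_set, hn]
        simp
      have h1 := (ih hv hc).1
      have h2 := Connected.totalDist_le_add v hv
      obtain ⟨h3, h4⟩ := hG.two_mul_sum_dist_add_card_le v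
      rw [hn] at h3 h4
      refine ⟨by rw [hn]; nlinarith, fun heq => hG.nonempty_iso_pathGraph (h4 ?_)⟩
      rw [hn] at heq
      nlinarith

theorem sum_range_sum_range_absDiff (n : ℕ) :
    -- With truncated subtraction the summand is |i - j|.
    3 * ∑ i ∈ Finset.range n, ∑ j ∈ Finset.range n, ((i - j) + (j - i)) + n = n ^ 3 := by
  induction n with
  | zero => simp
  | succ n ih =>
    have h1 : ∑ j ∈ Finset.range n, (n - j) + ∑ j ∈ Finset.range n, j = n * n := by
      rw [← Finset.sum_add_distrib, Finset.sum_congr rfl (g := fun _ => n)]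
      · simp
      · intro j hj
        have := Finset.mem_range.1 hj
        omega
    have h2 : (∑ j ∈ Finset.range n, j) * 2 + n = n * n := by
      rw [Finset.sum_range_id_mul_two]
      cases n with
      | zero => rfl
      | succ n => rw [Nat.add_sub_cancel]; ring
    have h3 : ∑ j ∈ Finset.range n, ((n - j) + (j - n)) = ∑ j ∈ Finset.range n, (n - j) :=
      Finset.sum_congr rfl fun j hj => by
        have := Finset.mem_range.1 hj
        omega
    have h4 : ∑ j ∈ Finset.range n, ((j - n) + (n - j)) = ∑ j ∈ Finset.range n, (n - j) :=
      Finset.sum_congr rfl fun j hj => by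
        have := Finset.mem_range.1 hj
        omega
    simp only [Finset.sum_range_succ, Finset.sum_add_distrib (f := fun i => ∑ j ∈ _, _), h3, h4,
      Nat.sub_self]
    have h5 : (n + 1) ^ 3 = n ^ 3 + 3 * (n * n) + 3 * n + 1 := by ring
    rw [h5, ← ih]
    omega

theorem Walk.val_le_add_length {n : ℕ} {i j : Fin n} (p : (pathGraph n).Walk i j) :
    i.val ≤ j.val + p.length := by
  induction p with
  | nil => simp
  | cons h p ih =>
    rw [pathGraph_adj] at h
    rw [Walk.length_cons]
    omega

/-- Every edge is a bridge: once the edge from v to v + 1 is removed, a walk cannot leave the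
vertices up to v. -/
theorem isTree_pathGraph {n : ℕ} (hn : n ≠ 0) : (pathGraph n).IsTree := by
  obtain ⟨m, rfl⟩ := Nat.exists_eq_succ_of_ne_zero hn
  refine ⟨pathGraph_connected m, ?_⟩
  have key : ∀ v w : Fin (m + 1), v.val + 1 = w.val →
      (pathGraph (m + 1)).IsBridge s(v, w) := by
    intro v w hvw
    rw [isBridge_iff]
    rintro ⟨p⟩
    have : ∀ {x y : Fin (m + 1)} (q : ((pathGraph (m + 1)).deleteEdges {s(v, w)}).Walk x y),
        x.val ≤ v.val → y.val ≤ v.val := by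
      intro x y q
      induction q with
      | nil => exact id
      | @cons a b c h q ih =>
        refine fun ha => ih ?_
        rw [deleteEdges_adj, pathGraph_adj] at h
        by_contra hb
        refine h.2 ?_
        have h1 : a = v := Fin.ext (by omega)
        have h2 : b = w := Fin.ext (by omega)
        rw [h1, h2]
        rfl
    have := this p le_rfl
    omega
  refine isAcyclic_iff_forall_adj_isBridge.2 fun v w hvw => ?_
  rcases pathGraph_adj.1 hvw with h | h
  · exact key v w h
  · rw [Sym2.eq_swap]
    exact key w v h

/-- The general bound gives one direction; for the other, a step of a walk changes the index by one,
so distances are at least |i - j|. -/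
theorem three_mul_totalDist_pathGraph {n : ℕ} (hn : n ≠ 0) :
    3 * (pathGraph n).totalDist + n = n ^ 3 := by
  have hT := isTree_pathGraph hn
  refine le_antisymm (by simpa using hT.connected.three_mul_totalDist_add_card_le.1) ?_
  rw [← sum_range_sum_range_absDiff n]
  refine Nat.add_le_add_right (Nat.mul_le_mul_left 3 ?_) n
  rw [← Fin.sum_univ_eq_sum_range (fun i => ∑ j ∈ Finset.range n, ((i - j) + (j - i)))]
  refine Finset.sum_le_sum fun i _ => ?_
  rw [← Fin.sum_univ_eq_sum_range (fun j => (i.val - j) + (j - i.val))]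
  refine Finset.sum_le_sum fun j _ => ?_
  obtain ⟨p, hp⟩ := hT.connected.exists_walk_length_eq_dist i j
  have h1 := p.val_le_add_length
  have h2 := p.reverse.val_le_add_length
  rw [Walk.length_reverse] at h2
  omega

end Path

/-! ### The star minimizes the sum of distances -/

section Star

variable {V : Type*} {G : SimpleGraph V}

/-- Among the trees of a given order, stars have the smallest sum of distances. -/
theorem IsTree.le_totalDist [Fintype V] (hG : G.IsTree) :
    2 * ((Fintype.card V : ℝ) - 1) ^ 2 ≤ G.totalDist ∧
      ((G.totalDist : ℝ) = 2 * ((Fintype.card V : ℝ) - 1) ^ 2 ↔ ∀ u v, G.dist u v ≤ 2) := by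
  classical
  -- The corrections raise the distances 0 and 1 to exactly 2. Their total depends only on the
  -- number of vertices, since the degrees of a tree sum to 2(n - 1).
  have hterm : ∀ u v, (0 : ℝ) ≤
      G.dist u v + (if u = v then 2 else 0) + (if G.Adj u v then 1 else 0) - 2 ∧
      ((G.dist u v : ℝ) + (if u = v then 2 else 0) + (if G.Adj u v then 1 else 0) - 2 = 0 ↔
        G.dist u v ≤ 2) := by
    intro u v
    by_cases huv : u = v
    · subst huv
      simp
    · by_cases ha : G.Adj u v
      · simp only [dist_eq_one_iff_adj.2 ha, huv, ha]
        norm_num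
      · have h1 := hG.connected.one_lt_dist_of_ne_of_not_adj huv ha
        have h2 : (2 : ℝ) ≤ G.dist u v := by exact_mod_cast h1
        simp only [huv, ha, if_false, add_zero]
        refine ⟨by linarith, fun h => ?_, fun h => ?_⟩
        · have : (G.dist u v : ℝ) = 2 := by linarith
          exact_mod_cast this.le
        · rw [le_antisymm h h1]
          norm_num
  have hsum : ∑ u, ∑ v, ((G.dist u v : ℝ) + (if u = v then 2 else 0) +
      (if G.Adj u v then 1 else 0) - 2) =
      G.totalDist - 2 * ((Fintype.card V : ℝ) - 1) ^ 2 := by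
    have hdeg : ∀ u, ∑ v, (if G.Adj u v then (1 : ℝ) else 0) = G.degree u := by
      intro u
      rw [← card_neighborFinset_eq_degree, neighborFinset_eq_filter]
      simp
    simp only [Finset.sum_sub_distrib, Finset.sum_add_distrib, hdeg, hG.sum_degree_real]
    simp [totalDist]
    ring
  have hnn := Finset.sum_nonneg fun u (_ : u ∈ Finset.univ) =>
    Finset.sum_nonneg fun v (_ : v ∈ Finset.univ) => (hterm u v).1
  rw [hsum] at hnn
  refine ⟨by linarith, ?_⟩
  rw [← sub_eq_zero, ← hsum, Finset.sum_eq_zero_iff_of_nonneg fun u _ =>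
    Finset.sum_nonneg fun v _ => (hterm u v).1]
  refine ⟨fun h u v => ?_, fun h u _ => Finset.sum_eq_zero fun v _ => (hterm u v).2.2 (h u v)⟩
  exact (hterm u v).2.1 ((Finset.sum_eq_zero_iff_of_nonneg fun v _ => (hterm u v).1).1
    (h u (Finset.mem_univ u)) v (Finset.mem_univ v))

theorem dist_starGraph_le_two (r u v : V) : (starGraph r).dist u v ≤ 2 := by
  have h : ∀ x, (starGraph r).dist x r ≤ 1 := by
    intro x
    by_cases hx : x = r
    · simp [hx]
    · exact (dist_eq_one_iff_adj.2 (starGraph_center_adj' (Ne.symm hx))).le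
  have h1 := (connected_starGraph r).dist_triangle (u := u) (v := r) (w := v)
  have h2 := h u
  have h3 := h v
  rw [dist_comm] at h3
  omega

/-- Any vertex c with two neighbours is a centre: if x were at distance 2 from c, each neighbour of
c would be at distance 1 from x, against uniqueness of the closer neighbour. If no vertex has two
neighbours, nothing is at distance 2. -/
theorem IsTree.exists_forall_ne_adj_of_dist_le_two (hG : G.IsTree)
    (h : ∀ u v, G.dist u v ≤ 2) : ∃ c, ∀ x, x ≠ c → G.Adj c x := by
  have htwo : ∀ c x, x ≠ c → ¬ G.Adj c x → G.dist c x = 2 := fun c x hx ha =>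
    le_antisymm (h c x) (hG.connected.one_lt_dist_of_ne_of_not_adj hx.symm ha)
  by_cases hc : ∃ c y z, y ≠ z ∧ G.Adj c y ∧ G.Adj c z
  · obtain ⟨c, y, z, hyz, hy, hz⟩ := hc
    refine ⟨c, fun x hx => ?_⟩
    by_contra ha
    have h2 := htwo c x hx ha
    have hclose : ∀ a, G.Adj c a → G.dist c x = G.dist a x + 1 := by
      intro a hca
      have h3 := hG.dist_eq_dist_add_one_of_adj x hca
      rw [dist_comm, dist_comm (u := x) (v := a)] at h3
      have := h a x
      omega
    exact hyz ((hG.existsUnique_adj_dist_succ hx.symm).unique ⟨hy, hclose y hy⟩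
      ⟨hz, hclose z hz⟩)
  · obtain ⟨c⟩ := hG.connected.nonempty
    refine ⟨c, fun x hx => ?_⟩
    by_contra ha
    have h2 := htwo c x hx ha
    obtain ⟨a, hca, had⟩ := hG.connected.exists_adj_dist_succ hx.symm
    have hax : G.Adj a x := dist_eq_one_iff_adj.1 (by omega)
    exact hc ⟨a, c, x, hx.symm, hca.symm, hax⟩

theorem nonempty_starGraph_iso (c r : V) : Nonempty (starGraph c ≃g starGraph r) := by
  classical
  refine ⟨⟨Equiv.swap c r, fun {x y} => ?_⟩⟩
  have h : ∀ z, Equiv.swap c r z = r ↔ z = c := fun z => by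
    rw [Equiv.swap_apply_eq_iff, Equiv.swap_apply_right]
  rw [starGraph_adj, starGraph_adj, h, h, (Equiv.swap c r).injective.ne_iff]

theorem IsTree.nonempty_iso_starGraph (hG : G.IsTree) (h : ∀ u v, G.dist u v ≤ 2) (r : V) :
    Nonempty (G ≃g starGraph r) := by
  obtain ⟨c, hc⟩ := hG.exists_forall_ne_adj_of_dist_le_two h
  have hstar : G = starGraph c := by
    ext x y
    rw [starGraph_adj]
    refine ⟨fun hxy => ⟨hxy.ne, ?_⟩, ?_⟩
    -- An edge avoiding `c` would join two vertices at distance 1 from `c`, but in a tree adjacent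
    -- vertices have different distances to `c`.
    · by_contra! hne
      refine hG.dist_ne_of_adj c hxy ?_
      rw [dist_eq_one_iff_adj.2 (hc x hne.1), dist_eq_one_iff_adj.2 (hc y hne.2)]
    · rintro ⟨hxy, rfl | rfl⟩
      · exact hc y hxy.symm
      · exact (hc x hxy).symm
  rw [hstar]
  exact nonempty_starGraph_iso c r

end Star

/-! ### Extremal values of the sum of distances and conclusion -/

section Extremal

variable {V : Type*} [Fintype V] {G : SimpleGraph V}

theorem IsTree.totalDist_le_pathGraph (hG : G.IsTree) :
    G.totalDist ≤ (pathGraph (Fintype.card V)).totalDist := by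
  have : Nonempty V := hG.connected.nonempty
  have h1 := hG.connected.three_mul_totalDist_add_card_le.1
  have h2 := three_mul_totalDist_pathGraph (n := Fintype.card V) Fintype.card_ne_zero
  omega

theorem IsTree.pathGraph_totalDist_le_iff (hG : G.IsTree) :
    (pathGraph (Fintype.card V)).totalDist ≤ G.totalDist ↔
      Nonempty (G ≃g pathGraph (Fintype.card V)) := by
  have : Nonempty V := hG.connected.nonempty
  have hP := isTree_pathGraph (n := Fintype.card V) Fintype.card_ne_zero
  have h2 := three_mul_totalDist_pathGraph (n := Fintype.card V) Fintype.card_ne_zero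
  refine ⟨fun h => hG.connected.three_mul_totalDist_add_card_le.2 ?_, ?_⟩
  · have := hG.totalDist_le_pathGraph
    omega
  · rintro ⟨e⟩
    exact (e.totalDist_eq hG.connected hP.connected).ge

theorem totalDist_starGraph (r : V) :
    ((starGraph r).totalDist : ℝ) = 2 * ((Fintype.card V : ℝ) - 1) ^ 2 :=
  (isTree_starGraph r).le_totalDist.2.2 (dist_starGraph_le_two r)

theorem IsTree.starGraph_totalDist_le (hG : G.IsTree) (r : V) :
    (starGraph r).totalDist ≤ G.totalDist := by
  have h := hG.le_totalDist.1
  rw [← totalDist_starGraph r] at h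
  exact_mod_cast h

theorem IsTree.totalDist_le_starGraph_iff (hG : G.IsTree) (r : V) :
    G.totalDist ≤ (starGraph r).totalDist ↔ Nonempty (G ≃g starGraph r) := by
  refine ⟨fun h => hG.nonempty_iso_starGraph (hG.le_totalDist.2.1 ?_) r, ?_⟩
  · rw [← totalDist_starGraph r, le_antisymm h (hG.starGraph_totalDist_le r)]
  · rintro ⟨e⟩
    exact (e.totalDist_eq hG.connected (connected_starGraph r)).le

end Extremal

end SimpleGraph

/-- Finiteness is stated for the path only: the inequalities pass it on to `T` and to the star. -/
theorem theorem1 {V : Type*} [Fintype V] (T : SimpleGraph V) (hT : T.IsTree) (r : V) :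
    -- the path has the largest average hitting time, and is the only tree that attains it
    (SimpleGraph.pathGraph (Fintype.card V)).averageHittingTime < ∞ ∧
    T.averageHittingTime ≤ (SimpleGraph.pathGraph (Fintype.card V)).averageHittingTime ∧
    (T.averageHittingTime = (SimpleGraph.pathGraph (Fintype.card V)).averageHittingTime ↔
      Nonempty (T ≃g SimpleGraph.pathGraph (Fintype.card V))) ∧
    -- the star has the smallest average hitting time, and is the only tree that attains it
    (SimpleGraph.starGraph r).averageHittingTime ≤ T.averageHittingTime ∧
    ((SimpleGraph.starGraph r).averageHittingTime = T.averageHittingTime ↔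
      Nonempty (T ≃g SimpleGraph.starGraph r)) ∧
    -- Kemeny's constant does not depend on the starting vertex
    (∀ u u' : V, T.kemeny u = T.kemeny u') ∧
    -- the path has the largest Kemeny's constant, and is the only tree that attains it
    (∀ p : Fin (Fintype.card V), (SimpleGraph.pathGraph (Fintype.card V)).kemeny p < ∞) ∧
    (∀ (u : V) (p : Fin (Fintype.card V)),
      T.kemeny u ≤ (SimpleGraph.pathGraph (Fintype.card V)).kemeny p ∧
      (T.kemeny u = (SimpleGraph.pathGraph (Fintype.card V)).kemeny p ↔
        Nonempty (T ≃g SimpleGraph.pathGraph (Fintype.card V)))) ∧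
    -- the star has the smallest Kemeny's constant, and is the only tree that attains it
    (∀ u s : V,
      (SimpleGraph.starGraph r).kemeny s ≤ T.kemeny u ∧
      ((SimpleGraph.starGraph r).kemeny s = T.kemeny u ↔
        Nonempty (T ≃g SimpleGraph.starGraph r))) := by
  have : Nonempty V := ⟨r⟩
  have hP := SimpleGraph.isTree_pathGraph (n := Fintype.card V) Fintype.card_ne_zero
  have hS := SimpleGraph.isTree_starGraph r
  have hc : Fintype.card V = Fintype.card (Fin (Fintype.card V)) := (Fintype.card_fin _).symm
  refine ⟨hP.averageHittingTime_lt_top, (hT.averageHittingTime_le_iff hP hc).2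
    hT.totalDist_le_pathGraph, ?_, (hS.averageHittingTime_le_iff hT rfl).2
    (hT.starGraph_totalDist_le r), ?_, fun u u' => ?_, hP.kemeny_lt_top, fun u p =>
    ⟨(hT.kemeny_le_iff hP hc u p).2 hT.totalDist_le_pathGraph, ?_⟩, fun u s =>
    ⟨(hS.kemeny_le_iff hT rfl s u).2 (hT.starGraph_totalDist_le r), ?_⟩⟩
  -- Equality is split into two inequalities between sums of distances; one always holds, the other
  -- characterizes the extremal tree.
  · rw [le_antisymm_iff, hT.averageHittingTime_le_iff hP hc,
      hP.averageHittingTime_le_iff hT hc.symm, hT.pathGraph_totalDist_le_iff]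
    exact and_iff_right hT.totalDist_le_pathGraph
  · rw [le_antisymm_iff, hS.averageHittingTime_le_iff hT rfl,
      hT.averageHittingTime_le_iff hS rfl, hT.totalDist_le_starGraph_iff]
    exact and_iff_right (hT.starGraph_totalDist_le r)
  · exact le_antisymm ((hT.kemeny_le_iff hT rfl u u').2 le_rfl)
      ((hT.kemeny_le_iff hT rfl u' u).2 le_rfl)
  · rw [le_antisymm_iff, hT.kemeny_le_iff hP hc, hP.kemeny_le_iff hT hc.symm,
      hT.pathGraph_totalDist_le_iff]
    exact and_iff_right hT.totalDist_le_pathGraph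
  · rw [le_antisymm_iff, hS.kemeny_le_iff hT rfl, hT.kemeny_le_iff hS rfl,
      hT.totalDist_le_starGraph_iff]
    exact and_iff_right (hT.starGraph_totalDist_le r)
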